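/- Consider a network with nodes $1,\dots,N$ and a finite family $\mathbb{S}$ of sources; each source $s\in\mathbb{S}$ is identified with the set of nodes that it connects, and "$x\in s$" means that $s$ connects the node $x$. Every node is connected to at least one source, and any two distinct nodes are both connected to at most one common source (no common double source). All Hilbert spaces are finite-dimensional. Each source $s$ prepares an arbitrary density matrix $\varrho_s$ on $\bigotimes_{x\in s}\mathcal{H}_{s,x}$ and sends the subsystem $\mathcal{H}_{s,x}$ to the node $x$; each node $x$ then applies a quantum channel (completely positive trace-preserving map) $\mathcal{E}_x$ from the system $\bigotimes_{s\ni x}\mathcal{H}_{s,x}$ that it received to an output system $\mathcal{K}_x$. The global state is $\varrho=\big(\bigotimes_{x=1}^N\mathcal{E}_x\big)\big(\bigotimes_{s\in\mathbb{S}}\varrho_s\big)$. For each node $x$ let $\{A_{x\mid i}\}_i$ be a finite family of observables (Hermitian operators) on $\mathcal{K}_x$, regarded as operators on $\bigotimes_y\mathcal{K}_y$ by padding with identities. Let $\Gamma$ be the covariance matrix of all these observables in the state $\varrho$, with entries $\Gamma_{(x,i),(y,j)}=\langle A_{x\mid i}A_{y\mid j}\rangle_\varrho-\langle A_{x\mid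 i}\rangle_\varrho\langle A_{y\mid j}\rangle_\varrho$, where $\langle X\rangle_\varrho=\operatorname{tr}(X\varrho)$. It is partitioned into $N\times N$ blocks labelled by the nodes; denote its off-diagonal blocks by $\gamma_{xy}$ ($x\neq y$). Then there exist matrices $\Upsilon_x^s$ ($s\in\mathbb{S}$, $x\in s$) and positive semidefinite (complex Hermitian) matrices $T_s$ ($s\in\mathbb{S}$), partitioned into blocks in the same way, such that $$\Gamma=\sum_{s\in\mathbb{S}}T_s,$$ and such that for every $s\in\mathbb{S}$ the off-diagonal block $(x,y)$, $x\neq y$, of $T_s$ equals $\gamma_{xy}$ if $\{x,y\}\subset s$ and $0$ if $\{x,y\}\not\subset s$, while the diagonal block $(x,x)$ of $T_s$ equals $\Upsilon_x^s$ if $x\in s$ and $0$ if $x\notin s$. -/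

import Mathlib

open scoped ComplexOrder

namespace QNet

/-- A density matrix on the finite-dimensional Hilbert space with orthonormal basis `H`. -/
def IsDensity {H : Type*} [Fintype H] (ρ : Matrix H H ℂ) : Prop :=
  ρ.PosSemidef ∧ ρ.trace = 1

/-- The ampliation `id_k ⊗ E` of a linear map `E` between matrix algebras: `E` is applied to each
of the `k × k` blocks of `X`. -/
def ampliation {I O : Type*} (E : Matrix I I ℂ →ₗ[ℂ] Matrix O O ℂ) (k : ℕ)
    (X : Matrix (Fin k × I) (Fin k × I) ℂ) : Matrix (Fin k × O) (Fin k × O) ℂ :=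
  Matrix.of fun p q => E (Matrix.of fun a b => X (p.1, a) (q.1, b)) p.2 q.2

/-- A quantum channel: a completely positive and trace preserving linear map. -/
structure IsChannel {I O : Type*} [Fintype I] [Fintype O]
    (E : Matrix I I ℂ →ₗ[ℂ] Matrix O O ℂ) : Prop where
  completelyPositive : ∀ (k : ℕ) (X : Matrix (Fin k × I) (Fin k × I) ℂ),
    X.PosSemidef → (ampliation E k X).PosSemidef
  tracePreserving : ∀ X : Matrix I I ℂ, (E X).trace = X.trace

/-- The tensor product `⨂ x, E x` of linear maps between matrix algebras, applied to a matrix on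
`⨂ x, H x`: the matrix unit `⨂ x, |a x⟩⟨b x|` is sent to `⨂ x, E x (|a x⟩⟨b x|)`, extended
linearly. A basis of the tensor product of the spaces `H x` is given by `∀ x, H x`. -/
def tensorMap {N : ℕ} {I O : Fin N → Type*} [∀ x, Fintype (I x)] [∀ x, DecidableEq (I x)]
    (E : ∀ x, Matrix (I x) (I x) ℂ →ₗ[ℂ] Matrix (O x) (O x) ℂ)
    (ρ : Matrix (∀ x, I x) (∀ x, I x) ℂ) : Matrix (∀ x, O x) (∀ x, O x) ℂ :=
  Matrix.of fun p q =>
    ∑ a : ∀ x, I x, ∑ b : ∀ x, I x,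
      ρ a b * ∏ x, E x (Matrix.single (a x) (b x) 1) (p x) (q x)

section Network

variable {N : ℕ} {S : Type*} (src : S → Finset (Fin N)) (K : S → Fin N → Type*)

/-- Basis of the system emitted by the source `s`: one subsystem, with basis `K s x`, for each node
`x` that `s` connects. -/
abbrev SourceBasis (s : S) : Type _ := ∀ x : {x // x ∈ src s}, K s x

/-- Basis of the system received by the node `x`: one subsystem, with basis `K s x`, from each
source `s` that connects `x`. -/
abbrev NodeBasis (x : Fin N) : Type _ := ∀ s : {s // x ∈ src s}, K s x

/-- The global state `⨂ s, ρ s` distributed by the sources, with its subsystems regrouped by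
nodes. -/
def basicState [Fintype S] (ρ : ∀ s, Matrix (SourceBasis src K s) (SourceBasis src K s) ℂ) :
    Matrix (∀ x, NodeBasis src K x) (∀ x, NodeBasis src K x) ℂ :=
  Matrix.of fun a b =>
    ∏ s, ρ s (fun x => a x.1 ⟨s, x.2⟩) (fun x => b x.1 ⟨s, x.2⟩)

/-- No common double source: any two distinct nodes share at most one source. -/
def NoCommonDoubleSource : Prop :=
  ∀ x y : Fin N, x ≠ y → ∀ s t : S,
    x ∈ src s → y ∈ src s → x ∈ src t → y ∈ src t → s = t

end Network

/-- The operator on `⨂ y, H y` that acts as `A` on the factor `x` and as the identity on the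
others. -/
def localOp {N : ℕ} {O : Fin N → Type*} [∀ x, DecidableEq (O x)] (x : Fin N)
    (A : Matrix (O x) (O x) ℂ) : Matrix (∀ y, O y) (∀ y, O y) ℂ :=
  Matrix.of fun p q => if ∀ y, y ≠ x → p y = q y then A (p x) (q x) else 0

/-- Expectation value `tr (X ρ)`. -/
def expect {H : Type*} [Fintype H] (ρ X : Matrix H H ℂ) : ℂ := (X * ρ).trace

/-- Covariance matrix `Γ_{mn} = ⟨M_m M_n⟩ - ⟨M_m⟩⟨M_n⟩` of a family of operators in a state. -/
def covMatrix {H J : Type*} [Fintype H] (M : J → Matrix H H ℂ) (ρ : Matrix H H ℂ) :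
    Matrix J J ℂ :=
  Matrix.of fun m n => expect ρ (M m * M n) - expect ρ (M m) * expect ρ (M n)

/-- The `(x, y)` block of a matrix whose rows and columns are labelled by pairs of a node and the
label of an observable on that node. -/
def block {N : ℕ} {J : Fin N → Type*} (Γ : Matrix (Σ x, J x) (Σ x, J x) ℂ) (x y : Fin N) :
    Matrix (J x) (J y) ℂ :=
  Matrix.of fun i j => Γ ⟨x, i⟩ ⟨y, j⟩

end QNet

/-!
The covariance matrix of a network without common double sources is a sum of covariance matrices of
the single sources plus a positive surplus on the diagonal blocks.

In the Heisenberg picture (`QNet.heisenberg`) every observable `A x i` becomes an operator `X x i`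
on the product state `⨂ s, ρ s`, which acts only on the sources that connect `x`
(`QNet.nodeOp_mem_supportedOn`). Averaging out all sources but `s` gives an operator on the system
of `s` (`QNet.condExp`), and the covariance matrix `C s` of these conditional expectations in the
state `ρ s` is positive semidefinite. It vanishes at the nodes that `s` does not connect, since
there the conditional expectation is a constant. Two distinct nodes share at most one source `s`, so
their observables are correlated through `s` only, and the off-diagonal block of `Γ` is the one of
`C s` (`QNet.expect_mul_eq_expect_condExp_mul`).

On a diagonal block, `Γ - ∑ s, C s` is positive semidefinite
(`QNet.covMatrix_localOp_sub_posSemidef`). For a linear combination `X` of the observables of one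
node, the mean of `X` plus its centred conditional expectations is the orthogonal projection `G` of
`X` onto the sums of one-source operators (`QNet.additivePart`), so that `⟨Gᴴ X⟩ = ⟨Gᴴ G⟩`; the
claim is Bessel's inequality, where the channel is dealt with by the Kadison–Schwarz inequality
(`QNet.IsChannel.schwarz`). The surplus of each node is added to one source that connects the node,
which exists because every node is connected to a source.
-/

namespace QNet

open Matrix

/-! ### Tensor products of matrices -/

section PiKronecker

variable {ι : Type*} [Fintype ι] {H : ι → Type*}

/-- The tensor product `⨂ i, M i` of a finite family of matrices, in the product basis. -/
def piKronecker (M : ∀ i, Matrix (H i) (H i) ℂ) : Matrix (∀ i, H i) (∀ i, H i) ℂ :=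
  Matrix.of fun a b => ∏ i, M i (a i) (b i)

lemma piKronecker_conjTranspose (M : ∀ i, Matrix (H i) (H i) ℂ) :
    (piKronecker M)ᴴ = piKronecker fun i => (M i)ᴴ := by
  ext a b
  simp [piKronecker]

lemma piKronecker_single [∀ i, DecidableEq (H i)] (a b : ∀ i, H i) :
    piKronecker (fun i => Matrix.single (a i) (b i) (1 : ℂ)) = Matrix.single a b 1 := by
  ext p q
  simp only [piKronecker, Matrix.of_apply, Matrix.single_apply, Finset.prod_ite_zero,
    Finset.prod_const_one, Finset.mem_univ, true_imp_iff, funext_iff, forall_and]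

lemma piKronecker_one [∀ i, DecidableEq (H i)] :
    piKronecker (1 : ∀ i, Matrix (H i) (H i) ℂ) = 1 := by
  ext p q
  simp only [piKronecker, Matrix.of_apply, Pi.one_apply, Matrix.one_apply, Finset.prod_ite_zero,
    Finset.prod_const_one, Finset.mem_univ, true_imp_iff, funext_iff]

/-- Tensor products of matrices span all matrices; stated as an induction principle. -/
lemma matrix_induction_piKronecker [∀ i, Finite (H i)]
    {p : Matrix (∀ i, H i) (∀ i, H i) ℂ → Prop} (hzero : p 0)
    (hadd : ∀ B C, p B → p C → p (B + C)) (hsmul : ∀ (c : ℂ) B, p B → p (c • B))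
    (hprod : ∀ M, p (piKronecker M)) (B : Matrix (∀ i, H i) (∀ i, H i) ℂ) : p B := by
  classical
  induction B using Matrix.induction_on' with
  | h_zero => exact hzero
  | h_add B C hB hC => exact hadd B C hB hC
  | h_std_basis a b c =>
    have := hsmul c _ (hprod fun i => Matrix.single (a i) (b i) 1)
    rwa [piKronecker_single, Matrix.smul_single, smul_eq_mul, mul_one] at this

variable [DecidableEq ι] [∀ i, Fintype (H i)]

lemma piKronecker_mul (M M' : ∀ i, Matrix (H i) (H i) ℂ) :
    piKronecker M * piKronecker M' = piKronecker (M * M') := by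
  ext a b
  simp only [piKronecker, Matrix.mul_apply, Matrix.of_apply, Pi.mul_apply, Fintype.prod_sum,
    Finset.prod_mul_distrib]

lemma trace_piKronecker (M : ∀ i, Matrix (H i) (H i) ℂ) :
    (piKronecker M).trace = ∏ i, (M i).trace := by
  simp only [piKronecker, Matrix.trace, Matrix.diag_apply, Matrix.of_apply, Fintype.prod_sum]

lemma expect_piKronecker (ρ M : ∀ i, Matrix (H i) (H i) ℂ) :
    expect (piKronecker ρ) (piKronecker M) = ∏ i, expect (ρ i) (M i) := by
  simp [expect, piKronecker_mul, trace_piKronecker]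

open scoped MatrixOrder in
lemma piKronecker_posSemidef {ρ : ∀ i, Matrix (H i) (H i) ℂ} (hρ : ∀ i, (ρ i).PosSemidef) :
    (piKronecker ρ).PosSemidef := by
  classical
  have h : ∀ i, ∃ B : Matrix (H i) (H i) ℂ, ρ i = Bᴴ * B := fun i =>
    CStarAlgebra.nonneg_iff_eq_star_mul_self.mp (hρ i).nonneg
  choose B hB using h
  have : piKronecker ρ = (piKronecker B)ᴴ * piKronecker B := by
    rw [piKronecker_conjTranspose, piKronecker_mul]
    congr 1
    funext i
    exact hB i
  rw [this]
  exact Matrix.posSemidef_conjTranspose_mul_self _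

end PiKronecker

/-! ### Expectation values -/

section Expect

variable {H : Type*} [Fintype H]

lemma expect_add (ρ X Y : Matrix H H ℂ) : expect ρ (X + Y) = expect ρ X + expect ρ Y := by
  simp [expect, add_mul]

lemma expect_sub (ρ X Y : Matrix H H ℂ) : expect ρ (X - Y) = expect ρ X - expect ρ Y := by
  simp [expect, sub_mul]

lemma expect_smul (ρ : Matrix H H ℂ) (c : ℂ) (X : Matrix H H ℂ) :
    expect ρ (c • X) = c * expect ρ X := by
  simp [expect]

lemma expect_sum {ι : Type*} (s : Finset ι) (ρ : Matrix H H ℂ) (X : ι → Matrix H H ℂ) :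
    expect ρ (∑ i ∈ s, X i) = ∑ i ∈ s, expect ρ (X i) := by
  simp [expect, Finset.sum_mul, Matrix.trace_sum]

lemma expect_one [DecidableEq H] {ρ : Matrix H H ℂ} (hρ : ρ.trace = 1) : expect ρ 1 = 1 := by
  simp [expect, hρ]

lemma expect_conjTranspose {ρ : Matrix H H ℂ} (hρ : ρ.IsHermitian) (X : Matrix H H ℂ) :
    expect ρ Xᴴ = star (expect ρ X) := by
  rw [expect, expect, ← Matrix.trace_conjTranspose, Matrix.conjTranspose_mul, hρ.eq,
    Matrix.trace_mul_comm]

lemma expect_conjTranspose_mul_self_nonneg {ρ : Matrix H H ℂ} (hρ : ρ.PosSemidef)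
    (X : Matrix H H ℂ) : 0 ≤ expect ρ (Xᴴ * X) := by
  rw [expect, Matrix.mul_assoc, Matrix.trace_mul_comm]
  exact (hρ.mul_mul_conjTranspose_same X).trace_nonneg

/-- Reordering a tensor product does not change expectation values. -/
lemma expect_submatrix {H' : Type*} [Fintype H'] (e : H' ≃ H) (ρ X : Matrix H H ℂ) :
    expect (ρ.submatrix e e) (X.submatrix e e) = expect ρ X := by
  rw [expect, Matrix.submatrix_mul_equiv, expect]
  simp only [Matrix.trace, Matrix.diag_apply, Matrix.submatrix_apply]
  exact e.sum_comp fun i => (X * ρ) i i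

end Expect

/-! ### Operators on one tensor factor -/

section LocalOp

variable {N : ℕ} {O : Fin N → Type*} [∀ x, DecidableEq (O x)]

lemma localOp_eq_piKronecker (x : Fin N) (A : Matrix (O x) (O x) ℂ) :
    localOp x A = piKronecker (Function.update 1 x A) := by
  ext p q
  have hrest : ∏ y ∈ Finset.univ.erase x, (Function.update 1 x A : ∀ y, Matrix (O y) (O y) ℂ) y
      (p y) (q y) = if ∀ y, y ≠ x → p y = q y then 1 else 0 := by
    rw [Finset.prod_congr rfl (g := fun y => if p y = q y then (1 : ℂ) else 0)]
    · simp [Finset.prod_ite_zero]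
    · intro y hy
      simp [Function.update_of_ne (Finset.ne_of_mem_erase hy), Matrix.one_apply]
  rw [piKronecker, Matrix.of_apply, ← Finset.mul_prod_erase _ _ (Finset.mem_univ x), hrest,
    Function.update_self]
  simp [localOp]

lemma localOp_add (x : Fin N) (A B : Matrix (O x) (O x) ℂ) :
    localOp x (A + B) = localOp x A + localOp x B := by
  ext p q
  simp only [localOp, Matrix.of_apply, Matrix.add_apply]
  split_ifs <;> simp

lemma localOp_smul (x : Fin N) (c : ℂ) (A : Matrix (O x) (O x) ℂ) :
    localOp x (c • A) = c • localOp x A := by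
  ext p q
  simp [localOp]

lemma localOp_zero (x : Fin N) : localOp x (0 : Matrix (O x) (O x) ℂ) = 0 := by
  ext p q
  simp [localOp]

lemma localOp_sum {ι : Type*} (s : Finset ι) (x : Fin N) (A : ι → Matrix (O x) (O x) ℂ) :
    localOp x (∑ i ∈ s, A i) = ∑ i ∈ s, localOp x (A i) :=
  map_sum (⟨⟨localOp x, localOp_zero x⟩, localOp_add x⟩ :
    Matrix (O x) (O x) ℂ →+ Matrix (∀ y, O y) (∀ y, O y) ℂ) A s

lemma localOp_conjTranspose (x : Fin N) (A : Matrix (O x) (O x) ℂ) :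
    (localOp x A)ᴴ = localOp x Aᴴ := by
  ext p q
  simp only [localOp, Matrix.conjTranspose_apply, Matrix.of_apply, eq_comm (a := q _)]
  split_ifs <;> simp

lemma localOp_mul [∀ x, Fintype (O x)] (x : Fin N) (A B : Matrix (O x) (O x) ℂ) :
    localOp x A * localOp x B = localOp x (A * B) := by
  rw [localOp_eq_piKronecker, localOp_eq_piKronecker, localOp_eq_piKronecker, piKronecker_mul,
    ← Function.update_mul, mul_one]

end LocalOp

/-! ### The Heisenberg picture of a channel -/

section Heisenberg

variable {I O : Type*} [Fintype O] [DecidableEq I]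

/-- The Heisenberg picture of `E`: the adjoint of `E` with respect to the bilinear form
`tr (A * X)`. -/
def heisenberg (E : Matrix I I ℂ →ₗ[ℂ] Matrix O O ℂ) : Matrix O O ℂ →ₗ[ℂ] Matrix I I ℂ where
  toFun A := Matrix.of fun b a => (A * E (Matrix.single a b 1)).trace
  map_add' A B := by ext; simp [add_mul]
  map_smul' c A := by ext; simp

variable [Fintype I]

lemma trace_heisenberg_mul (E : Matrix I I ℂ →ₗ[ℂ] Matrix O O ℂ) (A : Matrix O O ℂ)
    (X : Matrix I I ℂ) : (heisenberg E A * X).trace = (A * E X).trace := by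
  induction X using Matrix.induction_on' with
  | h_zero => simp
  | h_add B C hB hC => simp [mul_add, hB, hC]
  | h_std_basis a b c =>
    have : Matrix.single a b c = c • Matrix.single a b (1 : ℂ) := by simp
    rw [Matrix.trace_mul_single, this, map_smul, Matrix.mul_smul, Matrix.trace_smul]
    simp [heisenberg, mul_comm]

variable {E : Matrix I I ℂ →ₗ[ℂ] Matrix O O ℂ}

lemma IsChannel.heisenberg_one [DecidableEq O] (hE : IsChannel E) : heisenberg E 1 = 1 := by
  ext b a
  have : heisenberg E 1 b a = (Matrix.single a b (1 : ℂ)).trace := by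
    rw [← hE.tracePreserving]
    simp [heisenberg]
  rw [this, Matrix.one_apply]
  split_ifs with h
  · simp [h]
  · exact Matrix.trace_single_eq_of_ne _ _ _ (Ne.symm h)

/-- A channel preserves adjoints: `[[X Xᴴ, X], [Xᴴ, 1]]` is positive semidefinite, so its image
under `id₂ ⊗ E` is Hermitian. -/
lemma IsChannel.map_conjTranspose (hE : IsChannel E) (X : Matrix I I ℂ) : E Xᴴ = (E X)ᴴ := by
  let W : Matrix (Fin 2 × I) I ℂ := Matrix.of fun p c => (![X, 1] p.1) p.2 c
  have h := (hE.completelyPositive 2 _ (Matrix.posSemidef_self_mul_conjTranspose W)).isHermitian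
  have h01 : Matrix.of (fun a b => (W * Wᴴ) (0, a) (1, b)) = X := by
    ext a b
    simp [W, Matrix.mul_apply, Matrix.one_apply]
  have h10 : Matrix.of (fun a b => (W * Wᴴ) (1, a) (0, b)) = Xᴴ := by
    ext a b
    simp [W, Matrix.mul_apply, Matrix.one_apply]
  -- The entries of the two off-diagonal blocks of a Hermitian matrix.
  ext p q
  have := h.apply (1, p) (0, q)
  simp only [ampliation, Matrix.of_apply, h01, h10] at this
  exact this.symm

lemma IsChannel.heisenberg_conjTranspose (hE : IsChannel E) (A : Matrix O O ℂ) :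
    heisenberg E Aᴴ = (heisenberg E A)ᴴ := by
  ext b a
  have : Matrix.single a b (1 : ℂ) = (Matrix.single b a 1)ᴴ := by simp
  rw [Matrix.conjTranspose_apply]
  simp only [heisenberg, LinearMap.coe_mk, AddHom.coe_mk, Matrix.of_apply]
  rw [this, hE.map_conjTranspose, ← Matrix.conjTranspose_mul, Matrix.trace_conjTranspose,
    Matrix.trace_mul_comm]

end Heisenberg

/-! ### Expectation values after local channels -/

section TensorMap

variable {N : ℕ} {I O : Fin N → Type*} [∀ x, Fintype (I x)] [∀ x, DecidableEq (I x)]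
  [∀ x, Fintype (O x)]
  (E : ∀ x, Matrix (I x) (I x) ℂ →ₗ[ℂ] Matrix (O x) (O x) ℂ)
  (R : Matrix (∀ x, I x) (∀ x, I x) ℂ)

lemma expect_tensorMap_piKronecker (M : ∀ x, Matrix (O x) (O x) ℂ) :
    expect (tensorMap E R) (piKronecker M) =
      expect R (piKronecker fun x => heisenberg (E x) (M x)) := by
  have hE : tensorMap E R =
      ∑ a, ∑ b, R a b • piKronecker fun x => E x (Matrix.single (a x) (b x) 1) := by
    ext p q
    simp [tensorMap, piKronecker, Matrix.sum_apply]
  rw [hE, expect, expect]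
  simp only [Matrix.mul_sum, Matrix.trace_sum, Matrix.mul_smul, Matrix.trace_smul,
    piKronecker_mul, trace_piKronecker]
  rw [Matrix.trace_mul_comm]
  simp [Matrix.trace, Matrix.mul_apply, piKronecker, heisenberg]

variable [∀ x, DecidableEq (O x)] {E}

lemma expect_tensorMap_localOp (hE : ∀ x, IsChannel (E x)) (x : Fin N) (A : Matrix (O x) (O x) ℂ) :
    expect (tensorMap E R) (localOp x A) = expect R (localOp x (heisenberg (E x) A)) := by
  rw [localOp_eq_piKronecker, expect_tensorMap_piKronecker, localOp_eq_piKronecker]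
  congr 2
  funext z
  rcases eq_or_ne z x with rfl | hz
  · simp
  · simp [Function.update_of_ne hz, (hE z).heisenberg_one]

lemma expect_tensorMap_localOp_mul (hE : ∀ x, IsChannel (E x)) {x y : Fin N} (hxy : x ≠ y)
    (A : Matrix (O x) (O x) ℂ) (B : Matrix (O y) (O y) ℂ) :
    expect (tensorMap E R) (localOp x A * localOp y B) =
      expect R (localOp x (heisenberg (E x) A) * localOp y (heisenberg (E y) B)) := by
  simp only [localOp_eq_piKronecker, piKronecker_mul, expect_tensorMap_piKronecker]
  congr 2
  funext z
  rw [Pi.mul_apply, Pi.mul_apply]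
  by_cases hzx : z = x
  · subst hzx
    simp [Function.update_of_ne hxy]
  · by_cases hzy : z = y
    · subst hzy
      simp [Function.update_of_ne hzx]
    · simp [Function.update_of_ne hzx, Function.update_of_ne hzy, (hE z).heisenberg_one]

end TensorMap

/-! ### Partial traces and the Kadison–Schwarz inequality -/

section PartialTrace

variable {N : ℕ} {I : Fin N → Type*} [∀ x, Fintype (I x)]

/-- The partial trace over all tensor factors except `x`. -/
def partialTrace (x : Fin N) (Y : Matrix (∀ y, I y) (∀ y, I y) ℂ) : Matrix (I x) (I x) ℂ :=
  Matrix.of fun a b =>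
    ∑ h, Y ((Equiv.piSplitAt x I).symm (a, h)) ((Equiv.piSplitAt x I).symm (b, h))

lemma trace_localOp_mul [∀ x, DecidableEq (I x)] (x : Fin N) (B : Matrix (I x) (I x) ℂ)
    (Y : Matrix (∀ y, I y) (∀ y, I y) ℂ) :
    (localOp x B * Y).trace = (B * partialTrace x Y).trace := by
  have hloc : ∀ a h b h', localOp x B ((Equiv.piSplitAt x I).symm (a, h))
      ((Equiv.piSplitAt x I).symm (b, h')) = if h = h' then B a b else 0 := by
    intro a h b h'
    have hiff : (∀ y, y ≠ x → (Equiv.piSplitAt x I).symm (a, h) y =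
        (Equiv.piSplitAt x I).symm (b, h') y) ↔ h = h' := by
      simp only [Equiv.piSplitAt, Equiv.coe_fn_symm_mk, funext_iff, Subtype.forall]
      exact forall₂_congr fun y hy => by simp [hy]
    simp only [localOp, Matrix.of_apply, hiff]
    simp [Equiv.piSplitAt]
  simp only [Matrix.trace, Matrix.diag_apply, Matrix.mul_apply, partialTrace, Matrix.of_apply]
  rw [← (Equiv.piSplitAt x I).symm.sum_comp, Fintype.sum_prod_type]
  refine Finset.sum_congr rfl fun a _ => ?_
  simp only [← (Equiv.piSplitAt x I).symm.sum_comp (fun q => _ * Y q _),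
    Fintype.sum_prod_type, hloc]
  simp only [ite_mul, zero_mul, Finset.sum_ite_eq, Finset.mem_univ, if_true, Finset.mul_sum]
  exact Finset.sum_comm

/-- The partial trace over the factors other than `x` is completely positive: it preserves
positivity when applied to each of the `k × k` blocks of `Y`. -/
lemma partialTrace_blocks_posSemidef {k : ℕ} (x : Fin N)
    {Y : Matrix (Fin k × ∀ y, I y) (Fin k × ∀ y, I y) ℂ} (hY : Y.PosSemidef) :
    (Matrix.of fun p q : Fin k × I x => partialTrace x
      (Matrix.of fun a b => Y (p.1, a) (q.1, b)) p.2 q.2).PosSemidef := by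
  have h : (Matrix.of fun p q : Fin k × I x => partialTrace x
      (Matrix.of fun a b => Y (p.1, a) (q.1, b)) p.2 q.2) =
      ∑ h, Y.submatrix (fun p : Fin k × I x => (p.1, (Equiv.piSplitAt x I).symm (p.2, h)))
        (fun p : Fin k × I x => (p.1, (Equiv.piSplitAt x I).symm (p.2, h))) := by
    ext p q
    simp [partialTrace, Matrix.sum_apply]
  rw [h]
  exact Matrix.posSemidef_sum _ fun i _ => hY.submatrix _

end PartialTrace

/-- The Kadison–Schwarz inequality `Φ(Aᴴ) Φ(A) ≤ Φ(Aᴴ A)` for the Heisenberg picture `Φ` of a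
channel on the node `x`, in the variational form `0 ≤ ⟨(Φ(A) - G)ᴴ (Φ(A) - G)⟩` with `Φ(A)ᴴ Φ(A)`
replaced by `Φ(Aᴴ A)`. The operator `G` need not act on `x` only. -/
lemma IsChannel.schwarz {N : ℕ} {I : Fin N → Type*} [∀ x, Fintype (I x)]
    [∀ x, DecidableEq (I x)] {O : Type*} [Fintype O] [DecidableEq O] (x : Fin N)
    {E : Matrix (I x) (I x) ℂ →ₗ[ℂ] Matrix O O ℂ} (hE : IsChannel E)
    {R : Matrix (∀ y, I y) (∀ y, I y) ℂ} (hR : R.PosSemidef)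
    (A : Matrix O O ℂ) (G : Matrix (∀ y, I y) (∀ y, I y) ℂ) :
    0 ≤ expect R (localOp x (heisenberg E (Aᴴ * A))) - expect R (Gᴴ * localOp x (heisenberg E A))
      - expect R (localOp x (heisenberg E Aᴴ) * G) + expect R (Gᴴ * G) := by
  -- The block matrix `V p R (V q)ᴴ` is positive, hence so is its image under the partial trace and
  -- `id₂ ⊗ E`; compressing the result with the row `U = (A, 1)` and taking traces gives the claim.
  let V : Fin 2 → Matrix (∀ y, I y) (∀ y, I y) ℂ := ![1, -G]
  let W : Matrix (Fin 2 × ∀ y, I y) (∀ y, I y) ℂ := Matrix.of fun p c => V p.1 p.2 c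
  let U : Fin 2 → Matrix O O ℂ := ![A, 1]
  let Z : Matrix O (Fin 2 × O) ℂ := Matrix.of fun c p => U p.1 c p.2
  have hblock : ∀ p q : Fin 2, (Matrix.of fun a b => (W * R * Wᴴ) (p, a) (q, b)) =
      V p * R * (V q)ᴴ := by
    intro p q
    ext a b
    simp [W, Matrix.mul_apply]
  have hpos := partialTrace_blocks_posSemidef x (hR.mul_mul_conjTranspose_same W)
  simp only [hblock] at hpos
  have hZ := ((hE.completelyPositive 2 _ hpos).mul_mul_conjTranspose_same Z).trace_nonneg
  have hexp : ∀ p q : Fin 2, ((U q)ᴴ * U p * E (partialTrace x (V p * R * (V q)ᴴ))).trace =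
      expect R ((V q)ᴴ * localOp x (heisenberg E ((U q)ᴴ * U p)) * V p) := by
    intro p q
    rw [← trace_heisenberg_mul, ← trace_localOp_mul, expect, ← Matrix.mul_assoc,
      Matrix.trace_mul_comm]
    simp only [Matrix.mul_assoc]
  have htr : (Z * ampliation E 2 (Matrix.of fun p q : Fin 2 × I x => partialTrace x
      (V p.1 * R * (V q.1)ᴴ) p.2 q.2) * Zᴴ).trace =
      ∑ p, ∑ q, ((U q)ᴴ * U p * E (partialTrace x (V p * R * (V q)ᴴ))).trace := by
    have : Z * ampliation E 2 (Matrix.of fun p q : Fin 2 × I x => partialTrace x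
      (V p.1 * R * (V q.1)ᴴ) p.2 q.2) * Zᴴ =
      ∑ q, ∑ p, U p * E (partialTrace x (V p * R * (V q)ᴴ)) * (U q)ᴴ := by
      ext c d
      simp only [Matrix.mul_apply, Matrix.sum_apply, Fintype.sum_prod_type, ampliation, Z,
        Matrix.of_apply, Matrix.conjTranspose_apply, Finset.sum_mul]
      refine Finset.sum_congr rfl fun q _ => ?_
      rw [Finset.sum_comm]
      rfl
    rw [this, Finset.sum_comm]
    simp only [Matrix.trace_sum]
    refine Finset.sum_congr rfl fun p _ => Finset.sum_congr rfl fun q _ => ?_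
    rw [Matrix.trace_mul_comm, ← Matrix.mul_assoc]
  rw [htr] at hZ
  simp only [hexp, Fin.sum_univ_two] at hZ
  have h1 : localOp x (1 : Matrix (I x) (I x) ℂ) = 1 := by
    rw [localOp_eq_piKronecker, ← Pi.one_apply (M := fun y => Matrix (I y) (I y) ℂ) x,
      Function.update_eq_self, piKronecker_one]
  simp only [U, V, Matrix.cons_val_zero, Matrix.cons_val_one, Matrix.conjTranspose_one, one_mul,
    mul_one, Matrix.conjTranspose_neg, hE.heisenberg_one, h1, Matrix.mul_neg, Matrix.neg_mul,
    neg_neg] at hZ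
  have hneg : ∀ X, expect R (-X) = -expect R X := fun X => by simp [expect]
  rw [hneg, hneg] at hZ
  convert hZ using 1
  ring

/-! ### Conditional expectations in a product state -/

section ProductState

variable {S : Type*} [Fintype S] [DecidableEq S] {Q : S → Type*}

/-- The operator on `⨂ s, Q s` that acts as `F` on the factor `s`. -/
def factorOp [∀ s, DecidableEq (Q s)] (s : S) (F : Matrix (Q s) (Q s) ℂ) :
    Matrix (∀ s, Q s) (∀ s, Q s) ℂ :=
  piKronecker (Function.update 1 s F)

lemma factorOp_conjTranspose [∀ s, DecidableEq (Q s)] (s : S) (F : Matrix (Q s) (Q s) ℂ) :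
    (factorOp s F)ᴴ = factorOp s Fᴴ := by
  rw [factorOp, piKronecker_conjTranspose, factorOp]
  congr 1
  funext t
  rcases eq_or_ne t s with rfl | h
  · simp
  · simp [Function.update_of_ne h]

variable [∀ s, Fintype (Q s)]

/-- The conditional expectation onto the factor `s` in the product state `⨂ t, ρ t`: all other
factors are averaged out. -/
def condExp [∀ s, DecidableEq (Q s)] (ρ : ∀ s, Matrix (Q s) (Q s) ℂ) (s : S)
    (B : Matrix (∀ s, Q s) (∀ s, Q s) ℂ) : Matrix (Q s) (Q s) ℂ :=
  Matrix.of fun p q => expect (piKronecker (Function.update ρ s (Matrix.single q p 1))) B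

variable [∀ s, DecidableEq (Q s)] {ρ : ∀ s, Matrix (Q s) (Q s) ℂ}

lemma condExp_add (s : S) (B C : Matrix (∀ s, Q s) (∀ s, Q s) ℂ) :
    condExp ρ s (B + C) = condExp ρ s B + condExp ρ s C := by
  ext
  simp [condExp, expect_add]

lemma condExp_smul (s : S) (c : ℂ) (B : Matrix (∀ s, Q s) (∀ s, Q s) ℂ) :
    condExp ρ s (c • B) = c • condExp ρ s B := by
  ext
  simp [condExp, expect_smul]

lemma condExp_zero (s : S) : condExp ρ s 0 = 0 := by
  simpa using condExp_smul (ρ := ρ) s 0 0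

lemma condExp_sum {ι : Type*} (u : Finset ι) (s : S) (B : ι → Matrix (∀ s, Q s) (∀ s, Q s) ℂ) :
    condExp ρ s (∑ i ∈ u, B i) = ∑ i ∈ u, condExp ρ s (B i) :=
  map_sum (⟨⟨condExp ρ s, condExp_zero s⟩, condExp_add s⟩ :
    Matrix (∀ s, Q s) (∀ s, Q s) ℂ →+ Matrix (Q s) (Q s) ℂ) B u

lemma condExp_piKronecker (s : S) (M : ∀ s, Matrix (Q s) (Q s) ℂ) :
    condExp ρ s (piKronecker M) = (∏ t ∈ Finset.univ.erase s, expect (ρ t) (M t)) • M s := by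
  ext p q
  rw [condExp, Matrix.of_apply, expect_piKronecker, ← Finset.mul_prod_erase _ _ (Finset.mem_univ s),
    Finset.prod_congr rfl (g := fun t => expect (ρ t) (M t)), mul_comm]
  · simp [expect, Matrix.trace_mul_single]
  · intro t ht
    rw [Function.update_of_ne (Finset.ne_of_mem_erase ht)]

lemma condExp_conjTranspose (hρ : ∀ s, (ρ s).IsHermitian) (s : S)
    (B : Matrix (∀ s, Q s) (∀ s, Q s) ℂ) : condExp ρ s Bᴴ = (condExp ρ s B)ᴴ := by
  induction B using matrix_induction_piKronecker with
  | hzero => simp [condExp_zero]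
  | hadd B C hB hC => simp [condExp_add, hB, hC]
  | hsmul c B hB => simp [condExp_smul, hB]
  | hprod M =>
    simp [piKronecker_conjTranspose, condExp_piKronecker, expect_conjTranspose (hρ _)]

lemma expect_factorOp_mul (s : S) (F : Matrix (Q s) (Q s) ℂ)
    (B : Matrix (∀ s, Q s) (∀ s, Q s) ℂ) :
    expect (piKronecker ρ) (factorOp s F * B) = expect (ρ s) (F * condExp ρ s B) := by
  induction B using matrix_induction_piKronecker with
  | hzero => simp [condExp_zero, expect]
  | hadd B C hB hC => simp [condExp_add, mul_add, expect_add, hB, hC]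
  | hsmul c B hB => simp [condExp_smul, expect_smul, hB]
  | hprod M =>
    rw [factorOp, piKronecker_mul, expect_piKronecker, condExp_piKronecker, Matrix.mul_smul,
      expect_smul, ← Finset.mul_prod_erase _ _ (Finset.mem_univ s), mul_comm]
    congr 1
    · refine Finset.prod_congr rfl fun t ht => ?_
      simp [Function.update_of_ne (Finset.ne_of_mem_erase ht)]
    · simp

lemma condExp_factorOp_self (hρ : ∀ s, (ρ s).trace = 1) (s : S) (F : Matrix (Q s) (Q s) ℂ) :
    condExp ρ s (factorOp s F) = F := by
  rw [factorOp, condExp_piKronecker, Function.update_self, Finset.prod_eq_one, one_smul]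
  intro t ht
  simp [Function.update_of_ne (Finset.ne_of_mem_erase ht), expect_one (hρ t)]

lemma condExp_factorOp_of_ne (hρ : ∀ s, (ρ s).trace = 1) {s t : S} (hst : s ≠ t)
    (F : Matrix (Q t) (Q t) ℂ) :
    condExp ρ s (factorOp t F) = expect (ρ t) F • (1 : Matrix (Q s) (Q s) ℂ) := by
  rw [factorOp, condExp_piKronecker, Function.update_of_ne hst,
    Finset.prod_eq_single_of_mem t (by simp [hst.symm])]
  · simp
  · intro u _ hu
    simp [Function.update_of_ne hu, expect_one (hρ u)]

lemma condExp_one (hρ : ∀ s, (ρ s).trace = 1) (s : S) :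
    condExp ρ s (1 : Matrix (∀ s, Q s) (∀ s, Q s) ℂ) = 1 := by
  rw [← piKronecker_one, condExp_piKronecker, Finset.prod_eq_one]
  · simp
  · intro t _
    exact expect_one (hρ t)

lemma expect_condExp (s : S) (B : Matrix (∀ s, Q s) (∀ s, Q s) ℂ) :
    expect (ρ s) (condExp ρ s B) = expect (piKronecker ρ) B := by
  have h := expect_factorOp_mul (ρ := ρ) s 1 B
  rwa [factorOp, ← Pi.one_apply (M := fun s => Matrix (Q s) (Q s) ℂ) s, Function.update_eq_self,
    piKronecker_one, one_mul, Pi.one_apply, one_mul, eq_comm] at h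

/-- The additive part of `B` in the product state `⨂ s, ρ s`, that is, the sum of the terms of
order at most one in its Hoeffding decomposition: `⟨B⟩` plus the sum of the centred conditional
expectations of `B` onto the factors. -/
def additivePart (ρ : ∀ s, Matrix (Q s) (Q s) ℂ) (B : Matrix (∀ s, Q s) (∀ s, Q s) ℂ) :
    Matrix (∀ s, Q s) (∀ s, Q s) ℂ :=
  expect (piKronecker ρ) B • 1 +
    ∑ s, factorOp s (condExp ρ s B - expect (piKronecker ρ) B • 1)

lemma expect_condExp_sub (hρ : ∀ s, (ρ s).trace = 1) (s : S)
    (B : Matrix (∀ s, Q s) (∀ s, Q s) ℂ) :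
    expect (ρ s) (condExp ρ s B - expect (piKronecker ρ) B • 1) = 0 := by
  rw [expect_sub, expect_condExp, expect_smul, expect_one (hρ s), mul_one, sub_self]

lemma condExp_additivePart (hρ : ∀ s, (ρ s).trace = 1) (s : S)
    (B : Matrix (∀ s, Q s) (∀ s, Q s) ℂ) : condExp ρ s (additivePart ρ B) = condExp ρ s B := by
  rw [additivePart, condExp_add, condExp_smul, condExp_one hρ, condExp_sum,
    Finset.sum_eq_single_of_mem s (Finset.mem_univ s), condExp_factorOp_self hρ]
  · abel
  · intro t _ hts
    rw [condExp_factorOp_of_ne hρ hts.symm, expect_condExp_sub hρ, zero_smul]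

lemma expect_additivePart (hρ : ∀ s, (ρ s).trace = 1) (B : Matrix (∀ s, Q s) (∀ s, Q s) ℂ) :
    expect (piKronecker ρ) (additivePart ρ B) = expect (piKronecker ρ) B := by
  rw [additivePart, expect_add, expect_smul,
    expect_one (by rw [trace_piKronecker, Finset.prod_eq_one fun s _ => hρ s]), mul_one,
    expect_sum, Finset.sum_eq_zero, add_zero]
  intro s _
  have h := expect_factorOp_mul (ρ := ρ) s (condExp ρ s B - expect (piKronecker ρ) B • 1) 1
  rwa [mul_one, condExp_one hρ, mul_one, expect_condExp_sub hρ] at h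

/-- The correlation of the additive part of `B` with `C` only sees the conditional expectations. -/
lemma expect_additivePart_conjTranspose_mul
    (B C : Matrix (∀ s, Q s) (∀ s, Q s) ℂ) :
    expect (piKronecker ρ) ((additivePart ρ B)ᴴ * C) =
      star (expect (piKronecker ρ) B) * expect (piKronecker ρ) C +
      ∑ s, (expect (ρ s) ((condExp ρ s B)ᴴ * condExp ρ s C) -
        star (expect (piKronecker ρ) B) * expect (piKronecker ρ) C) := by
  simp only [additivePart, Matrix.conjTranspose_add, Matrix.conjTranspose_smul,
    Matrix.conjTranspose_one, Matrix.conjTranspose_sum, factorOp_conjTranspose, add_mul,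
    Finset.sum_mul, expect_add, expect_sum, expect_factorOp_mul, Matrix.smul_mul, one_mul,
    expect_smul, Matrix.conjTranspose_sub, sub_mul, expect_sub, expect_condExp]

/-- Bessel's equality: the additive part of `B` is its orthogonal projection, so that
`⟨Gᴴ B⟩ = ⟨Gᴴ G⟩`. -/
lemma expect_additivePart_conjTranspose_mul_self (hρ : ∀ s, (ρ s).trace = 1)
    (B : Matrix (∀ s, Q s) (∀ s, Q s) ℂ) :
    expect (piKronecker ρ) ((additivePart ρ B)ᴴ * additivePart ρ B) =
      expect (piKronecker ρ) ((additivePart ρ B)ᴴ * B) := by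
  simp only [expect_additivePart_conjTranspose_mul, expect_additivePart hρ,
    condExp_additivePart hρ]

section Support

/-- The operators on `⨂ s, Q s` that act as the identity on all factors outside `P`. -/
def supportedOn (Q : S → Type*) [∀ s, DecidableEq (Q s)] (P : Set S) :
    Submodule ℂ (Matrix (∀ s, Q s) (∀ s, Q s) ℂ) :=
  Submodule.span ℂ {B | ∃ M : ∀ s, Matrix (Q s) (Q s) ℂ, (∀ s, s ∉ P → M s = 1) ∧
    B = piKronecker M}

variable {P P' : Set S} {B B' : Matrix (∀ s, Q s) (∀ s, Q s) ℂ}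

lemma condExp_of_notMem (hρ : ∀ s, (ρ s).trace = 1) (hB : B ∈ supportedOn Q P) {s : S}
    (hs : s ∉ P) : condExp ρ s B = expect (piKronecker ρ) B • 1 := by
  induction hB using Submodule.span_induction with
  | mem B hB =>
    obtain ⟨M, hM, rfl⟩ := hB
    rw [condExp_piKronecker, expect_piKronecker, ← Finset.mul_prod_erase _ _ (Finset.mem_univ s),
      hM s hs, expect_one (hρ s), one_mul]
  | zero => simp [condExp_zero, expect]
  | add B C _ _ hB hC => rw [condExp_add, hB, hC, expect_add, add_smul]
  | smul c B _ hB => rw [condExp_smul, hB, expect_smul, mul_smul]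

/-- In a product state, operators whose supports meet in at most the factor `s` are correlated
through `s` only. -/
lemma expect_mul_eq_expect_condExp_mul (hρ : ∀ s, (ρ s).trace = 1) (hB : B ∈ supportedOn Q P)
    (hB' : B' ∈ supportedOn Q P') (s : S) (hs : ∀ t, t ∈ P → t ∈ P' → t = s) :
    expect (piKronecker ρ) (B * B') = expect (ρ s) (condExp ρ s B * condExp ρ s B') := by
  induction hB using Submodule.span_induction with
  | zero => simp [condExp_zero, expect]
  | add B C _ _ hB hC => simp only [condExp_add, add_mul, expect_add, hB, hC]
  | smul c B _ hB => simp only [condExp_smul, Matrix.smul_mul, expect_smul, hB]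
  | mem B hB =>
    obtain ⟨M, hM, rfl⟩ := hB
    induction hB' using Submodule.span_induction with
    | zero => simp [condExp_zero, expect]
    | add B C _ _ hB hC => simp only [condExp_add, mul_add, expect_add, hB, hC]
    | smul c B _ hB => simp only [condExp_smul, Matrix.mul_smul, expect_smul, hB]
    | mem B' hB' =>
      obtain ⟨M', hM', rfl⟩ := hB'
      rw [piKronecker_mul, expect_piKronecker, condExp_piKronecker, condExp_piKronecker,
        Matrix.smul_mul, Matrix.mul_smul, expect_smul, expect_smul,
        ← Finset.mul_prod_erase _ _ (Finset.mem_univ s), ← mul_assoc, ← Finset.prod_mul_distrib,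
        mul_comm, Pi.mul_apply]
      congr 1
      refine Finset.prod_congr rfl fun t ht => ?_
      rw [Pi.mul_apply]
      by_cases htP : t ∈ P
      · rw [hM' t fun h => Finset.ne_of_mem_erase ht (hs t htP h), mul_one, expect_one (hρ t),
          mul_one]
      · rw [hM t htP, one_mul, expect_one (hρ t), one_mul]

end Support

end ProductState

/-! ### Covariance matrices -/

section Covariance

variable {H J : Type*} [Fintype H]

lemma covMatrix_isHermitian {M : J → Matrix H H ℂ} (hM : ∀ j, (M j).IsHermitian)
    {ρ : Matrix H H ℂ} (hρ : ρ.IsHermitian) : (covMatrix M ρ).IsHermitian := by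
  ext i j
  have h1 : expect ρ (M i * M j) = star (expect ρ (M j * M i)) := by
    rw [← expect_conjTranspose hρ, Matrix.conjTranspose_mul, (hM i).eq, (hM j).eq]
  have h2 : ∀ k, star (expect ρ (M k)) = expect ρ (M k) := fun k => by
    rw [← expect_conjTranspose hρ, (hM k).eq]
  rw [Matrix.conjTranspose_apply, covMatrix, Matrix.of_apply, Matrix.of_apply, star_sub, ← h1,
    star_mul', h2, h2, mul_comm (expect ρ (M j))]

variable [Fintype J]

lemma expect_sum_conjTranspose_mul_sum {M : J → Matrix H H ℂ} (hM : ∀ j, (M j).IsHermitian)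
    (ρ : Matrix H H ℂ) (c : J → ℂ) :
    expect ρ ((∑ j, c j • M j)ᴴ * ∑ j, c j • M j) =
      ∑ i, ∑ j, star (c i) * (c j * expect ρ (M i * M j)) := by
  simp only [Matrix.conjTranspose_sum, Matrix.conjTranspose_smul, fun j => (hM j).eq,
    Finset.sum_mul, Matrix.mul_sum, Matrix.smul_mul, Matrix.mul_smul, expect_sum, expect_smul]
  exact Finset.sum_congr rfl fun i _ => Finset.sum_congr rfl fun j _ => mul_left_comm _ _ _

lemma star_expect_mul_expect_sum {M : J → Matrix H H ℂ} (hM : ∀ j, (M j).IsHermitian)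
    {ρ : Matrix H H ℂ} (hρ : ρ.IsHermitian) (c : J → ℂ) :
    star (expect ρ (∑ j, c j • M j)) * expect ρ (∑ j, c j • M j) =
      ∑ i, ∑ j, star (c i) * (c j * (expect ρ (M i) * expect ρ (M j))) := by
  have h2 : ∀ k, star (expect ρ (M k)) = expect ρ (M k) := fun k => by
    rw [← expect_conjTranspose hρ, (hM k).eq]
  simp only [expect_sum, expect_smul, star_sum, star_mul', h2, Finset.sum_mul_sum]
  exact Finset.sum_congr rfl fun i _ => Finset.sum_congr rfl fun j _ => by ring

/-- The quadratic form of a covariance matrix is the variance of a linear combination. -/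
lemma star_dotProduct_covMatrix_mulVec {M : J → Matrix H H ℂ} (hM : ∀ j, (M j).IsHermitian)
    {ρ : Matrix H H ℂ} (hρ : ρ.IsHermitian) (c : J → ℂ) :
    star c ⬝ᵥ (covMatrix M ρ *ᵥ c) =
      expect ρ ((∑ j, c j • M j)ᴴ * ∑ j, c j • M j) -
        star (expect ρ (∑ j, c j • M j)) * expect ρ (∑ j, c j • M j) := by
  rw [expect_sum_conjTranspose_mul_sum hM, star_expect_mul_expect_sum hM hρ]
  simp only [dotProduct, Matrix.mulVec, Finset.mul_sum, ← Finset.sum_sub_distrib]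
  refine Finset.sum_congr rfl fun i _ => Finset.sum_congr rfl fun j _ => ?_
  simp only [Pi.star_apply, covMatrix, Matrix.of_apply]
  ring

lemma covMatrix_posSemidef [DecidableEq H] {M : J → Matrix H H ℂ} (hM : ∀ j, (M j).IsHermitian)
    {ρ : Matrix H H ℂ} (hρ : IsDensity ρ) : (covMatrix M ρ).PosSemidef := by
  refine Matrix.PosSemidef.of_dotProduct_mulVec_nonneg (covMatrix_isHermitian hM hρ.1.1) fun c => ?_
  rw [star_dotProduct_covMatrix_mulVec hM hρ.1.1]
  set X := ∑ j, c j • M j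
  have h := expect_conjTranspose_mul_self_nonneg hρ.1 (X - expect ρ X • 1)
  simp only [Matrix.conjTranspose_sub, Matrix.conjTranspose_smul, Matrix.conjTranspose_one, sub_mul,
    mul_sub, expect_sub, Matrix.smul_mul, Matrix.mul_smul, one_mul, mul_one, expect_smul,
    expect_conjTranspose hρ.1.1, expect_one hρ.2] at h
  convert h using 1
  ring

end Covariance

open scoped MatrixOrder in
lemma blockDiagonal'_posSemidef {ι : Type*} [Fintype ι] [DecidableEq ι] {J : ι → Type*}
    [∀ x, Fintype (J x)] {D : ∀ x, Matrix (J x) (J x) ℂ} (hD : ∀ x, (D x).PosSemidef) :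
    (Matrix.blockDiagonal' D).PosSemidef := by
  classical
  have h : ∀ x, ∃ B : Matrix (J x) (J x) ℂ, D x = Bᴴ * B := fun x =>
    CStarAlgebra.nonneg_iff_eq_star_mul_self.mp (hD x).nonneg
  choose B hB using h
  have : Matrix.blockDiagonal' D = (Matrix.blockDiagonal' B)ᴴ * Matrix.blockDiagonal' B := by
    rw [Matrix.blockDiagonal'_conjTranspose, ← Matrix.blockDiagonal'_mul]
    exact congrArg _ (funext hB)
  rw [this]
  exact Matrix.posSemidef_conjTranspose_mul_self _

/-! ### Covariances in a network -/

section Network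

variable {N : ℕ} {S : Type*} (src : S → Finset (Fin N)) (K : S → Fin N → Type*)

/-- The regrouping of the subsystems of all nodes into those of all sources. -/
def regroup : (∀ x, NodeBasis src K x) ≃ (∀ s, SourceBasis src K s) where
  toFun a s x := a x.1 ⟨s, x.2⟩
  invFun b x s := b s.1 ⟨x, s.2⟩
  left_inv _ := rfl
  right_inv _ := rfl

lemma basicState_eq_submatrix [Fintype S]
    (ρ : ∀ s, Matrix (SourceBasis src K s) (SourceBasis src K s) ℂ) :
    basicState src K ρ = (piKronecker ρ).submatrix (regroup src K) (regroup src K) :=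
  rfl

lemma expect_basicState [Fintype S] [DecidableEq S] [∀ s x, Fintype (K s x)]
    (ρ : ∀ s, Matrix (SourceBasis src K s) (SourceBasis src K s) ℂ)
    (X : Matrix (∀ s, SourceBasis src K s) (∀ s, SourceBasis src K s) ℂ) :
    expect (basicState src K ρ) (X.submatrix (regroup src K) (regroup src K)) =
      expect (piKronecker ρ) X := by
  rw [basicState_eq_submatrix, expect_submatrix]

/-- The subsystems of a network, listed by nodes or by sources. -/
def linkEquiv : (Σ x : Fin N, {s // x ∈ src s}) ≃ (Σ s : S, {x // x ∈ src s}) where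
  toFun p := ⟨p.2.1, p.1, p.2.2⟩
  invFun p := ⟨p.2.1, p.1, p.2.2⟩
  left_inv _ := rfl
  right_inv _ := rfl

variable [Fintype S] [∀ s x, DecidableEq (K s x)]

/-- The operator that acts as `B` on the node `x` and as the identity on the other nodes, as an
operator on the tensor product of the systems emitted by the sources. -/
def nodeOp (x : Fin N) (B : Matrix (NodeBasis src K x) (NodeBasis src K x) ℂ) :
    Matrix (∀ s, SourceBasis src K s) (∀ s, SourceBasis src K s) ℂ :=
  (localOp x B).submatrix (regroup src K).symm (regroup src K).symm

variable {src K}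

lemma nodeOp_submatrix (x : Fin N) (B : Matrix (NodeBasis src K x) (NodeBasis src K x) ℂ) :
    (nodeOp src K x B).submatrix (regroup src K) (regroup src K) = localOp x B := by
  simp [nodeOp, Matrix.submatrix_submatrix]

lemma nodeOp_sum_smul {ι : Type*} (u : Finset ι) (x : Fin N) (c : ι → ℂ)
    (B : ι → Matrix (NodeBasis src K x) (NodeBasis src K x) ℂ) :
    nodeOp src K x (∑ i ∈ u, c i • B i) = ∑ i ∈ u, c i • nodeOp src K x (B i) := by
  ext
  simp [nodeOp, localOp_sum, localOp_smul, Matrix.sum_apply]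

lemma nodeOp_conjTranspose (x : Fin N) (B : Matrix (NodeBasis src K x) (NodeBasis src K x) ℂ) :
    (nodeOp src K x B)ᴴ = nodeOp src K x Bᴴ := by
  rw [nodeOp, Matrix.conjTranspose_submatrix, localOp_conjTranspose, nodeOp]

variable [∀ s x, Fintype (K s x)]

/-- An operator on the node `x` acts only on the systems of the sources that connect `x`. -/
lemma nodeOp_mem_supportedOn (x : Fin N) (B : Matrix (NodeBasis src K x) (NodeBasis src K x) ℂ) :
    nodeOp src K x B ∈ supportedOn (SourceBasis src K) {s | x ∈ src s} := by
  induction B using matrix_induction_piKronecker with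
  | hzero => simp [nodeOp, localOp_zero]
  | hadd B C hB hC => rw [nodeOp, localOp_add]; exact Submodule.add_mem _ hB hC
  | hsmul c B hB => rw [nodeOp, localOp_smul]; exact Submodule.smul_mem _ c hB
  | hprod β =>
    -- `μ z s` is the factor of the operator on the subsystem that `s` sends to `z`.
    let μ : ∀ (z : Fin N) (s : {s // z ∈ src s}), Matrix (K s z) (K s z) ℂ :=
      Function.update (fun _ _ => 1) x β
    refine Submodule.subset_span ⟨fun s => piKronecker fun z => μ z.1 ⟨s, z.2⟩, ?_, ?_⟩
    · intro s hs
      rw [← piKronecker_one]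
      refine congrArg piKronecker (funext fun z => ?_)
      have hz : z.1 ≠ x := fun h => hs (h ▸ z.2)
      simp [μ, Function.update_of_ne hz]
    · have hμ : (Function.update 1 x (piKronecker β) :
          ∀ z, Matrix (NodeBasis src K z) (NodeBasis src K z) ℂ) = fun z => piKronecker (μ z) := by
        funext z
        rcases eq_or_ne z x with rfl | hz
        · simp [μ]
        · simp only [μ, Function.update_of_ne hz]
          exact piKronecker_one.symm
      ext a b
      rw [nodeOp, localOp_eq_piKronecker, hμ]
      simp only [piKronecker, Matrix.submatrix_apply, Matrix.of_apply]
      rw [← Fintype.prod_sigma', ← Fintype.prod_sigma']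
      exact Fintype.prod_equiv (linkEquiv src) _ _ fun _ => rfl

variable [DecidableEq S] {ρ : ∀ s, Matrix (SourceBasis src K s) (SourceBasis src K s) ℂ}

lemma expect_basicState_localOp (x : Fin N)
    (B : Matrix (NodeBasis src K x) (NodeBasis src K x) ℂ) :
    expect (basicState src K ρ) (localOp x B) = expect (piKronecker ρ) (nodeOp src K x B) := by
  rw [← expect_basicState, nodeOp_submatrix]

lemma expect_basicState_localOp_mul (x y : Fin N)
    (B : Matrix (NodeBasis src K x) (NodeBasis src K x) ℂ)
    (C : Matrix (NodeBasis src K y) (NodeBasis src K y) ℂ) :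
    expect (basicState src K ρ) (localOp x B * localOp y C) =
      expect (piKronecker ρ) (nodeOp src K x B * nodeOp src K y C) := by
  rw [← expect_basicState, ← Matrix.submatrix_mul_equiv _ _ _ (regroup src K), nodeOp_submatrix,
    nodeOp_submatrix]

variable {O : Fin N → Type*} [∀ x, Fintype (O x)] [∀ x, DecidableEq (O x)]
  {E : ∀ x, Matrix (NodeBasis src K x) (NodeBasis src K x) ℂ →ₗ[ℂ] Matrix (O x) (O x) ℂ}

/-- Expectation values at the node `x` are those of its reduced state, sent through its channel. -/
lemma expect_tensorMap_localOp_eq_expect_partialTrace (hE : ∀ x, IsChannel (E x)) (x : Fin N)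
    (A : Matrix (O x) (O x) ℂ) :
    expect (tensorMap E (basicState src K ρ)) (localOp x A) =
      expect (E x (partialTrace x (basicState src K ρ))) A := by
  rw [expect_tensorMap_localOp _ hE, expect, trace_localOp_mul, trace_heisenberg_mul, expect]

/-- At a single node, the covariance matrix of the output observables dominates the sum over the
sources of the covariance matrices of the conditional expectations of their pull-backs. -/
lemma covMatrix_localOp_sub_posSemidef (hρ : ∀ s, IsDensity (ρ s)) (hE : ∀ x, IsChannel (E x))
    (x : Fin N) {J : Type*} [Fintype J] {A : J → Matrix (O x) (O x) ℂ}
    (hA : ∀ i, (A i).IsHermitian) :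
    (covMatrix (fun i => localOp x (A i)) (tensorMap E (basicState src K ρ)) -
      ∑ s, covMatrix (fun i => condExp ρ s (nodeOp src K x (heisenberg (E x) (A i))))
        (ρ s)).PosSemidef := by
  set R := basicState src K ρ with hRdef
  have hR : R.PosSemidef := (piKronecker_posSemidef fun s => (hρ s).1).submatrix _
  have hρh : ∀ s, (ρ s).IsHermitian := fun s => (hρ s).1.1
  have hρ1 : ∀ s, (ρ s).trace = 1 := fun s => (hρ s).2
  -- The output state at the node `x`.
  set ω := E x (partialTrace x R) with hωdef
  have hω : ω.IsHermitian := by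
    have : (partialTrace x R).IsHermitian := by
      ext a b
      simp [partialTrace, hR.1.apply]
    rw [Matrix.IsHermitian, hωdef, ← (hE x).map_conjTranspose, this.eq]
  have hcov : covMatrix (fun i => localOp x (A i)) (tensorMap E R) = covMatrix A ω := by
    ext i j
    simp only [covMatrix, Matrix.of_apply, localOp_mul, hRdef,
      expect_tensorMap_localOp_eq_expect_partialTrace hE, hωdef]
  have hC : ∀ s i, (condExp ρ s (nodeOp src K x (heisenberg (E x) (A i)))).IsHermitian := by
    intro s i
    rw [Matrix.IsHermitian, ← condExp_conjTranspose hρh, nodeOp_conjTranspose,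
      ← (hE x).heisenberg_conjTranspose, (hA i).eq]
  rw [hcov]
  refine Matrix.PosSemidef.of_dotProduct_mulVec_nonneg ((covMatrix_isHermitian hA hω).sub ?_)
    fun c => ?_
  · rw [Matrix.IsHermitian, Matrix.conjTranspose_sum]
    exact Finset.sum_congr rfl fun s _ => (covMatrix_isHermitian (hC s) (hρh s)).eq
  set a := ∑ j, c j • A j with ha
  set X := nodeOp src K x (heisenberg (E x) a) with hX
  have hCX : ∀ s, ∑ j, c j • condExp ρ s (nodeOp src K x (heisenberg (E x) (A j))) =
      condExp ρ s X := by
    intro s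
    simp only [hX, ha, map_sum, map_smul, nodeOp_sum_smul, condExp_sum, condExp_smul]
  have hωX : ∀ B, expect ω B = expect (piKronecker ρ) (nodeOp src K x (heisenberg (E x) B)) := by
    intro B
    rw [hωdef, hRdef, ← expect_tensorMap_localOp_eq_expect_partialTrace hE,
      expect_tensorMap_localOp _ hE, expect_basicState_localOp]
  simp only [Matrix.sub_mulVec, Matrix.sum_mulVec, dotProduct_sub, dotProduct_sum,
    star_dotProduct_covMatrix_mulVec hA hω, star_dotProduct_covMatrix_mulVec (hC _) (hρh _),
    hCX, expect_condExp, ← ha]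
  -- Kadison–Schwarz at the additive part of the pulled-back observable, plus Bessel's equality.
  set G := additivePart ρ X with hG
  have hsch := (hE x).schwarz x hR a (G.submatrix (regroup src K) (regroup src K))
  rw [Matrix.conjTranspose_submatrix, ← nodeOp_submatrix, ← nodeOp_submatrix, ← nodeOp_submatrix,
    Matrix.submatrix_mul_equiv, Matrix.submatrix_mul_equiv, Matrix.submatrix_mul_equiv, hRdef,
    expect_basicState, expect_basicState, expect_basicState, expect_basicState,
    (hE x).heisenberg_conjTranspose, ← nodeOp_conjTranspose, ← hX, ← hωX] at hsch
  have hGG : expect (piKronecker ρ) (Gᴴ * G) = expect (piKronecker ρ) (Gᴴ * X) :=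
    expect_additivePart_conjTranspose_mul_self hρ1 X
  -- `⟨Gᴴ G⟩` is real, so that both cross terms are equal to it.
  have hXG : expect (piKronecker ρ) (Xᴴ * G) = expect (piKronecker ρ) (Gᴴ * G) := by
    have hh := (piKronecker_posSemidef fun s => (hρ s).1).1
    have h1 := expect_conjTranspose hh (Gᴴ * X)
    have h2 := expect_conjTranspose hh (Gᴴ * G)
    rw [Matrix.conjTranspose_mul, Matrix.conjTranspose_conjTranspose] at h1 h2
    rw [h1, ← hGG, ← h2]
  rw [hXG, hGG, hG, expect_additivePart_conjTranspose_mul] at hsch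
  convert hsch using 1
  rw [hωX a, ← hX]
  ring

/-- Observables at two distinct nodes that share at most the source `s` are correlated through
`s` only. -/
lemma covMatrix_localOp_apply_of_ne (hρ : ∀ s, IsDensity (ρ s)) (hE : ∀ x, IsChannel (E x))
    {J : Fin N → Type*} (A : ∀ x, J x → Matrix (O x) (O x) ℂ) {x y : Fin N} (hxy : x ≠ y) (s : S)
    (hs : ∀ t, x ∈ src t → y ∈ src t → t = s) (i : J x) (j : J y) :
    covMatrix (fun m : Σ x, J x => localOp m.1 (A m.1 m.2))
      (tensorMap E (basicState src K ρ)) ⟨x, i⟩ ⟨y, j⟩ =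
    covMatrix (fun m : Σ x, J x => condExp ρ s (nodeOp src K m.1 (heisenberg (E m.1) (A m.1 m.2))))
      (ρ s) ⟨x, i⟩ ⟨y, j⟩ := by
  simp only [covMatrix, Matrix.of_apply]
  rw [expect_tensorMap_localOp_mul _ hE hxy, expect_tensorMap_localOp _ hE,
    expect_tensorMap_localOp _ hE, expect_basicState_localOp_mul, expect_basicState_localOp,
    expect_basicState_localOp, expect_condExp, expect_condExp,
    expect_mul_eq_expect_condExp_mul (fun s => (hρ s).2) (nodeOp_mem_supportedOn x _)
      (nodeOp_mem_supportedOn y _) s hs]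

/-- A source contributes nothing to the covariances of a node that it does not connect. -/
lemma covMatrix_condExp_apply_of_notMem (hρ : ∀ s, IsDensity (ρ s)) {J : Type*}
    {M : J → Matrix (∀ s, SourceBasis src K s) (∀ s, SourceBasis src K s) ℂ}
    {s : S} {x : Fin N} (hx : x ∉ src s) {i j : J}
    (h : M i ∈ supportedOn (SourceBasis src K) {s | x ∈ src s} ∨
      M j ∈ supportedOn (SourceBasis src K) {s | x ∈ src s}) :
    covMatrix (fun m => condExp ρ s (M m)) (ρ s) i j = 0 := by
  simp only [covMatrix, Matrix.of_apply]
  rcases h with h | h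
  · rw [condExp_of_notMem (fun s => (hρ s).2) h hx]
    simp [expect_smul, expect_one (hρ s).2]
  · rw [condExp_of_notMem (fun s => (hρ s).2) h hx]
    simp [expect_smul, expect_one (hρ s).2, mul_comm]

end Network

end QNet

/-! ### The decomposition of the covariance matrix -/

theorem proposition7 {N : ℕ} {S : Type*} [Fintype S] [DecidableEq S]
    -- the sources `s : S`, and the set of nodes that each of them connects
    (src : S → Finset (Fin N))
    (hncds : QNet.NoCommonDoubleSource src)
    (hcover : ∀ x : Fin N, ∃ s : S, x ∈ src s)
    -- the source states
    (K : S → Fin N → Type*) [∀ s x, Fintype (K s x)] [∀ s x, DecidableEq (K s x)]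
    (ρ : ∀ s, Matrix (QNet.SourceBasis src K s) (QNet.SourceBasis src K s) ℂ)
    (hρ : ∀ s, QNet.IsDensity (ρ s))
    -- the local channels
    (O : Fin N → Type*) [∀ x, Fintype (O x)] [∀ x, DecidableEq (O x)]
    (E : ∀ x, Matrix (QNet.NodeBasis src K x) (QNet.NodeBasis src K x) ℂ →ₗ[ℂ]
      Matrix (O x) (O x) ℂ)
    (hE : ∀ x, QNet.IsChannel (E x))
    -- the local observables
    (J : Fin N → Type*) [∀ x, Fintype (J x)]
    (A : ∀ x, J x → Matrix (O x) (O x) ℂ)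
    (hA : ∀ x i, (A x i).IsHermitian)
    -- the covariance matrix of the global state
    (Γ : Matrix (Σ x, J x) (Σ x, J x) ℂ)
    (hΓ : Γ = QNet.covMatrix (fun m : Σ x, J x => QNet.localOp m.1 (A m.1 m.2))
      (QNet.tensorMap E (QNet.basicState src K ρ))) :
    ∃ (Υ : ∀ (s : S) (x : Fin N), x ∈ src s → Matrix (J x) (J x) ℂ)
      (T : S → Matrix (Σ x, J x) (Σ x, J x) ℂ),
      Γ = ∑ s, T s ∧
      ∀ s : S, (T s).PosSemidef ∧
        (∀ x y, x ≠ y → x ∈ src s → y ∈ src s →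
          QNet.block (T s) x y = QNet.block Γ x y) ∧
        (∀ x y, x ≠ y → ¬ (x ∈ src s ∧ y ∈ src s) → QNet.block (T s) x y = 0) ∧
        (∀ x (hx : x ∈ src s), QNet.block (T s) x x = Υ s x hx) ∧
        (∀ x, x ∉ src s → QNet.block (T s) x x = 0) := by
  choose s₀ hs₀ using hcover
  let X : (Σ x, J x) → Matrix (∀ s, QNet.SourceBasis src K s) (∀ s, QNet.SourceBasis src K s) ℂ :=
    fun m => QNet.nodeOp src K m.1 (QNet.heisenberg (E m.1) (A m.1 m.2))
  have hX : ∀ m, X m ∈ QNet.supportedOn (QNet.SourceBasis src K) {s | m.1 ∈ src s} := fun m =>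
    QNet.nodeOp_mem_supportedOn _ _
  let C : S → Matrix (Σ x, J x) (Σ x, J x) ℂ := fun s =>
    QNet.covMatrix (fun m => QNet.condExp ρ s (X m)) (ρ s)
  have hC : ∀ s, (C s).PosSemidef := by
    refine fun s => QNet.covMatrix_posSemidef (fun m => ?_) (hρ s)
    rw [Matrix.IsHermitian, ← QNet.condExp_conjTranspose fun s => (hρ s).1.1]
    simp only [X, QNet.nodeOp_conjTranspose, ← (hE _).heisenberg_conjTranspose, (hA _ _).eq]
  -- The part of the diagonal blocks that the sources do not account for.
  let D : ∀ x, Matrix (J x) (J x) ℂ := fun x =>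
    QNet.covMatrix (fun i => QNet.localOp x (A x i)) (QNet.tensorMap E (QNet.basicState src K ρ)) -
      ∑ s, QNet.covMatrix
        (fun i => QNet.condExp ρ s (QNet.nodeOp src K x (QNet.heisenberg (E x) (A x i)))) (ρ s)
  have hD : ∀ x, (D x).PosSemidef := fun x =>
    QNet.covMatrix_localOp_sub_posSemidef hρ hE x (hA x)
  -- The surplus of the node `x` is assigned to one source `s₀ x` that connects it.
  let T : S → Matrix (Σ x, J x) (Σ x, J x) ℂ := fun s =>
    C s + Matrix.blockDiagonal' fun x => if s = s₀ x then D x else 0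
  have hoff : ∀ s x y i j, x ≠ y → T s ⟨x, i⟩ ⟨y, j⟩ = C s ⟨x, i⟩ ⟨y, j⟩ := by
    intro s x y i j hxy
    simp [T, Matrix.blockDiagonal'_apply_ne _ _ _ hxy]
  have hC0 : ∀ s x y i j, ¬ (x ∈ src s ∧ y ∈ src s) → C s ⟨x, i⟩ ⟨y, j⟩ = 0 := by
    intro s x y i j h
    by_cases hx : x ∈ src s
    · exact QNet.covMatrix_condExp_apply_of_notMem hρ (fun hy => h ⟨hx, hy⟩) (.inr (hX ⟨y, j⟩))
    · exact QNet.covMatrix_condExp_apply_of_notMem hρ hx (.inl (hX ⟨x, i⟩))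
  have hΓC : ∀ s x y i j, x ≠ y → (∀ t, x ∈ src t → y ∈ src t → t = s) →
      Γ ⟨x, i⟩ ⟨y, j⟩ = C s ⟨x, i⟩ ⟨y, j⟩ := by
    intro s x y i j hxy hs
    rw [hΓ]
    exact QNet.covMatrix_localOp_apply_of_ne hρ hE A hxy s hs i j
  refine ⟨fun s x _ => QNet.block (T s) x x, T, ?_, fun s => ⟨?_, ?_, ?_, fun _ _ => rfl, ?_⟩⟩
  · ext ⟨x, i⟩ ⟨y, j⟩
    rw [Matrix.sum_apply]
    rcases eq_or_ne x y with rfl | hxy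
    · have h : ∀ s, T s ⟨x, i⟩ ⟨x, j⟩ = C s ⟨x, i⟩ ⟨x, j⟩ + if s = s₀ x then D x i j else 0 := by
        intro s
        simp only [T, Matrix.add_apply, Matrix.blockDiagonal'_apply_eq]
        split_ifs <;> rfl
      simp only [h, Finset.sum_add_distrib, Finset.sum_ite_eq', Finset.mem_univ, if_true, D,
        Matrix.sub_apply, Matrix.sum_apply]
      rw [hΓ]
      exact (add_sub_cancel _ _).symm
    · obtain ⟨s, hs⟩ : ∃ s, ∀ t, x ∈ src t → y ∈ src t → t = s := by
        by_cases h : ∃ t, x ∈ src t ∧ y ∈ src t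
        · obtain ⟨s, hx, hy⟩ := h
          exact ⟨s, fun t htx hty => hncds x y hxy t s htx hty hx hy⟩
        · exact ⟨s₀ x, fun t htx hty => absurd ⟨t, htx, hty⟩ h⟩
      rw [Finset.sum_eq_single_of_mem s (Finset.mem_univ s), hoff _ _ _ _ _ hxy,
        hΓC s x y i j hxy hs]
      intro t _ hts
      rw [hoff _ _ _ _ _ hxy, hC0 _ _ _ _ _ fun h => hts (hs t h.1 h.2)]
  · refine (hC s).add (QNet.blockDiagonal'_posSemidef fun x => ?_)
    split_ifs
    exacts [hD x, .zero]
  · intro x y hxy hx hy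
    ext i j
    simp only [QNet.block, Matrix.of_apply]
    rw [hoff _ _ _ _ _ hxy, hΓC s x y i j hxy fun t htx hty => hncds x y hxy t s htx hty hx hy]
  · intro x y hxy h
    ext i j
    simp only [QNet.block, Matrix.of_apply, Matrix.zero_apply]
    rw [hoff _ _ _ _ _ hxy, hC0 _ _ _ _ _ h]
  · intro x hx
    ext i j
    have hne : s ≠ s₀ x := fun h => hx (h ▸ hs₀ x)
    simp only [QNet.block, Matrix.of_apply, Matrix.zero_apply, T, Matrix.add_apply,
      Matrix.blockDiagonal'_apply_eq, if_neg hne]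
    rw [hC0 _ _ _ _ _ fun h => hx h.1, add_zero]
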